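/- For $\mathbf w=(w_1,w_2,\ldots)$ let $p_i(\mathbf w)=(1-w_1)\cdots(1-w_{i-1})\,w_i$. Let $W_1,W_2,\ldots,U_1,U_2,\ldots$ be independent random variables, uniformly distributed on $[0,1]$. Put $R_0=0$, $R_k=\sum_{i=1}^k p_i(W_1,W_2,\ldots)$ and $I_k=[R_{k-1},R_k)$, let $n(k)=\inf\{n\ge 1: U_n\notin[0,R_k)\}\in\{1,2,\ldots\}\cup\{\infty\}$, and let $$u_k=\mathbb P\Big(\bigcap_{i=1}^k\{U_j\in I_i\text{ for some }1\le j<n(k)\}\Big),$$ which is the probability that the first $k$ intervals discovered by the sample points $U_1,U_2,\ldots$ are $I_1,\ldots,I_k$ in some order. Let $\mathfrak S_k$ be the set of permutations of $\{1,\ldots,k\}$ and $\zeta$ the Riemann zeta function. Then for each $k\ge 1$ all the integrals below converge absolutely, the series converges, and $$\sum_{\pi\in\mathfrak S_k}\int_{(0,1)^k}p_{\pi(1)}(\mathbf w)\prod_{i=2}^k\frac{p_{\pi(i)}(\mathbf w)}{1-\sum_{j=1}^{i-1}p_{\pi(j)}(\mathbf w)}\,dw_1\cdots dw_k$$ is equal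 to $$(-1)^{k-1}\Big(2-\frac{3}{2^k}\Big)+\sum_{j=2}^k(-1)^{k-j}\Big(2-\frac1{2^{k-j}}\Big)\zeta(j),$$ to $$\sum_{j=1}^\infty\frac{2}{j^k(j+1)(j+2)},$$ and to $u_k$. -/

import Mathlib

open MeasureTheory

namespace StickBreaking

noncomputable section

/-- The stick-breaking lengths `p_i(w) = (1 - w_1) ⋯ (1 - w_{i-1}) w_i`, for a family `w` of real
numbers. The index set is `Fin k` for finite families and `ℕ` for infinite sequences; in both
cases indices start from `0`, so that the `i`-th factor is `w (i - 1)`. -/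
def stick {ι : Type} [LinearOrder ι] [LocallyFiniteOrderBot ι] (w : ι → ℝ) (i : ι) : ℝ :=
  (∏ j ∈ Finset.Iio i, (1 - w j)) * w i

/-- The open unit cube `(0,1)^k`. -/
def openCube (k : ℕ) : Set (Fin k → ℝ) :=
  Set.univ.pi fun _ => Set.Ioo (0 : ℝ) 1

/-- The integrand `p_{π(1)} ∏_{i=2}^k p_{π(i)} / (1 - ∑_{j<i} p_{π(j)})`. The factor of the
first index has an empty sum in its denominator and is `p_{π(1)} / 1`. -/
def orderIntegrand {k : ℕ} (π : Equiv.Perm (Fin k)) (w : Fin k → ℝ) : ℝ :=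
  ∏ i : Fin k, stick w (π i) / (1 - ∑ j ∈ Finset.Iio i, stick w (π j))

/-- The sum over all permutations of the integrals over `(0,1)^k` with respect to
Lebesgue measure. -/
def orderIntegralSum (k : ℕ) : ℝ :=
  ∑ π : Equiv.Perm (Fin k), ∫ w in openCube k, orderIntegrand π w

/-- The end points `R_k = p_1 + ⋯ + p_k` of the intervals, with `R_0 = 0`. -/
def endpoint (w : ℕ → ℝ) (k : ℕ) : ℝ :=
  ∑ i ∈ Finset.range k, stick w i

/-- The intervals `[R_{i-1}, R_i)`, numbered from `0`. -/
def interval (w : ℕ → ℝ) (i : ℕ) : Set ℝ :=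
  Set.Ico (endpoint w i) (endpoint w (i + 1))

/-- The first time at which a sample point falls outside `[0, R_k)`, and `⊤` if there is none.
The sample points are numbered from `0`. -/
def exitTime (w x : ℕ → ℝ) (k : ℕ) : ℕ∞ :=
  ⨅ (n : ℕ) (_ : x n ∉ Set.Ico 0 (endpoint w k)), (n : ℕ∞)

/-- The uniform distribution on `[0,1]`. -/
def uniform01 : Measure ℝ := volume.restrict (Set.Icc 0 1)

instance : IsProbabilityMeasure uniform01 :=
  ⟨by simp [uniform01]⟩

/-- The joint law of the stick-breaking factors `(W_1, W_2, …)` and the sample points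
`(U_1, U_2, …)`: all of them are independent and uniform on `[0,1]`. -/
def samplingLaw : Measure ((ℕ → ℝ) × (ℕ → ℝ)) :=
  (Measure.infinitePi fun _ : ℕ => uniform01).prod (Measure.infinitePi fun _ : ℕ => uniform01)

/-- The event that each of the first `k` intervals contains a sample point drawn before the first
sample point outside `[0, R_k)`. -/
def discoveryEvent (k : ℕ) : Set ((ℕ → ℝ) × (ℕ → ℝ)) :=
  {ω | ∀ i < k, ∃ j : ℕ, (j : ℕ∞) < exitTime ω.1 ω.2 k ∧ ω.2 j ∈ interval ω.1 i}

/-- The renewal probability `u_k`. -/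
def u (k : ℕ) : ℝ := samplingLaw.real (discoveryEvent k)

end

end StickBreaking

/-! Fix the factors `w`, with stick lengths `p i` and remaining mass `T = ∏ (1 - w i)`, so that `T +
∑ p i = 1`. Give each stick an exponential clock of rate `p i`, and the remainder one of rate `T`.
The chance that all sticks ring before the remainder is `expIntegral`. Conditioning on the first
clock to ring gives a recursion over finite sets of sticks. The conditional discovery probability
satisfies it (`infinitePi_real_hitSet_eq_expIntegral`), and so does the sum over orders of discovery
(`sum_perm_prod_eq_expIntegral`). This identifies the integrals with `u k`.

To average over `w`, integrate over the cube before integrating over the time `t`. The resulting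
`clockDensity k` starts from `exp (-t)`. Prepending a stick rescales the others, so each step from
`k` to `k + 1` applies the integral operator with the positive part of `stickKernel`
(`clockDensity_succ`). Its transpose has positive eigenfunctions `h_n` with eigenvalues `1 / (n +
1)`, and `∑ (n + 1) h_n = 1`. Pairing `clockDensity k` with this expansion of `1` gives the series,
the `n`-th term being `(n + 1) * (n + 1)^(-k) * ∫ exp (-t) h_n(t) dt`. All terms are nonnegative, so
Tonelli applies throughout. Partial fractions turn the series into zeta values. -/

namespace StickBreaking

/-! ### Sampling until the first exit -/

section Sampling

variable {α ι : Type*} [MeasurableSpace α] [DecidableEq ι]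

/-- The sequence obtained by putting a term in front of a given sequence. -/
def consSeq (q : α × (ℕ → α)) : ℕ → α := fun n => Nat.casesOn n q.1 q.2

lemma measurable_consSeq : Measurable (consSeq : α × (ℕ → α) → ℕ → α) := by
  refine measurable_pi_iff.2 fun n => ?_
  cases n with
  | zero => exact measurable_fst
  | succ n => exact (measurable_pi_apply n).comp measurable_snd

/-- The law of an i.i.d. sequence is that of its first term followed by an independent copy of the
sequence. -/
lemma map_consSeq_prod_infinitePi (ν : Measure α) [IsProbabilityMeasure ν] :
    (ν.prod (Measure.infinitePi fun _ : ℕ => ν)).map consSeq =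
      Measure.infinitePi fun _ : ℕ => ν := by
  refine Measure.eq_infinitePi _ fun s t ht => ?_
  rw [Measure.map_apply measurable_consSeq (MeasurableSet.pi s.countable_toSet fun i _ => ht i)]
  have hpre : consSeq ⁻¹' ((s : Set ℕ).pi t) =
      (if 0 ∈ s then t 0 else Set.univ) ×ˢ
        ((s.preimage Nat.succ (Nat.succ_injective.injOn) : Finset ℕ) : Set ℕ).pi
          fun i => t (i + 1) := by
    ext q
    simp only [Set.mem_preimage, Set.mem_pi, Finset.mem_coe, Set.mem_prod, Finset.mem_preimage]
    constructor
    · intro h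
      refine ⟨?_, fun i hi => h (i + 1) hi⟩
      split_ifs with h0
      · exact h 0 h0
      · trivial
    · rintro ⟨h0, h1⟩ i hi
      cases i with
      | zero => simpa [consSeq, hi] using h0
      | succ i => exact h1 i hi
  rw [hpre, Measure.prod_prod, Measure.infinitePi_pi _ (fun i _ => ht _)]
  have himg : ∏ i ∈ s.preimage Nat.succ (Nat.succ_injective.injOn), ν (t (i + 1)) =
      ∏ i ∈ s.erase 0, ν (t i) := by
    refine Finset.prod_bij (fun i _ => i + 1) ?_ ?_ ?_ ?_
    · intro i hi
      simpa using hi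
    · intro i _ j _ h
      simpa using h
    · intro i hi
      obtain ⟨h0, hi⟩ := Finset.mem_erase.1 hi
      obtain ⟨j, rfl⟩ := Nat.exists_eq_succ_of_ne_zero h0
      exact ⟨j, by simpa using hi, rfl⟩
    · intro i _
      rfl
  rw [himg]
  split_ifs with h0
  · exact Finset.mul_prod_erase s (fun i => ν (t i)) h0
  · rw [Finset.erase_eq_of_notMem h0, measure_univ, one_mul]

/-- The set of sequences in which each of the sets `J i`, `i ∈ S`, is visited before the first exit
from `⋃ i ∈ K, J i`. -/
def hitSet (J : ι → Set α) (K S : Finset ι) : Set (ℕ → α) :=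
  {x | ∀ i ∈ S, ∃ j, x j ∈ J i ∧ ∀ l ≤ j, ∃ m ∈ K, x l ∈ J m}

omit [DecidableEq ι] in
lemma measurableSet_hitSet {J : ι → Set α} (hJ : ∀ i, MeasurableSet (J i)) (K S : Finset ι) :
    MeasurableSet (hitSet J K S) := by
  have : hitSet J K S = ⋂ i ∈ S, ⋃ j : ℕ, ((fun x => x j) ⁻¹' J i ∩
      ⋂ l ∈ Finset.Iic j, ⋃ m ∈ K, (fun x => x l) ⁻¹' J m) := by
    ext x
    simp [hitSet]
  rw [this]
  refine Finset.measurableSet_biInter _ fun i _ => MeasurableSet.iUnion fun j =>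
    (measurable_pi_apply j (hJ i)).inter <| Finset.measurableSet_biInter _ fun l _ =>
      Finset.measurableSet_biUnion _ fun m _ => measurable_pi_apply l (hJ m)

omit [MeasurableSpace α] in
-- The first sample must land in some `J i` with `i ∈ K`, since otherwise the exit happens at once
-- and nothing in the nonempty `S` is visited. Disjointness makes this `i` unique, and the remaining
-- samples then have to visit `S.erase i`.
lemma preimage_consSeq_hitSet {J : ι → Set α} (hd : Pairwise (Function.onFun Disjoint J))
    {K S : Finset ι} (hS : S.Nonempty) :
    consSeq ⁻¹' hitSet J K S = ⋃ i ∈ K, J i ×ˢ hitSet J K (S.erase i) := by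
  have huniq : ∀ {i m y}, y ∈ J i → y ∈ J m → i = m := fun {i m y} hi hm => by
    by_contra h
    exact Set.disjoint_left.1 (hd h) hi hm
  ext q
  simp only [Set.mem_preimage, Set.mem_iUnion, Set.mem_prod, exists_prop]
  constructor
  · intro h
    obtain ⟨i₀, hi₀⟩ := hS
    obtain ⟨j, -, hj⟩ := h i₀ hi₀
    obtain ⟨m, hm, hqm⟩ := hj 0 (Nat.zero_le _)
    refine ⟨m, hm, hqm, fun i hi => ?_⟩
    obtain ⟨him, hi⟩ := Finset.mem_erase.1 hi
    obtain ⟨j, hj, hl⟩ := h i hi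
    cases j with
    | zero => exact absurd (huniq hj hqm) him
    | succ j => exact ⟨j, hj, fun l hlj => hl (l + 1) (by omega)⟩
  · rintro ⟨m, hm, hqm, h⟩ i hi
    by_cases him : i = m
    · subst him
      refine ⟨0, hqm, fun l hl => ?_⟩
      obtain rfl : l = 0 := by omega
      exact ⟨i, hm, hqm⟩
    · obtain ⟨j, hj, hl⟩ := h i (Finset.mem_erase.2 ⟨him, hi⟩)
      refine ⟨j + 1, hj, fun l hlj => ?_⟩
      cases l with
      | zero => exact ⟨m, hm, hqm⟩
      | succ l => exact hl l (by omega)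

/-- First step analysis of the probability of `hitSet`. -/
lemma infinitePi_real_hitSet (ν : Measure α) [IsProbabilityMeasure ν] {J : ι → Set α}
    (hJ : ∀ i, MeasurableSet (J i)) (hd : Pairwise (Function.onFun Disjoint J))
    {K S : Finset ι} (hS : S.Nonempty) :
    (Measure.infinitePi fun _ : ℕ => ν).real (hitSet J K S) =
      ∑ i ∈ K, ν.real (J i) *
        (Measure.infinitePi fun _ : ℕ => ν).real (hitSet J K (S.erase i)) := by
  conv_lhs => rw [← map_consSeq_prod_infinitePi ν]
  rw [map_measureReal_apply measurable_consSeq (measurableSet_hitSet hJ K S),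
    preimage_consSeq_hitSet hd hS, measureReal_biUnion_finset]
  · simp [measureReal_prod_prod]
  · intro i _ j _ hij
    exact Set.disjoint_prod.2 (Or.inl (hd hij))
  · intro i _
    exact (hJ i).prod (measurableSet_hitSet hJ K _)

end Sampling

/-! ### The exponential integral for the order of discovery -/

section ExpIntegral

open Filter Topology

variable {ι : Type*} [DecidableEq ι]

/-- The integrand of `expIntegral`. -/
noncomputable def expIntegrand (T : ℝ) (p : ι → ℝ) (S : Finset ι) (t : ℝ) : ℝ :=
  T * Real.exp (-T * t) * ∏ i ∈ S, (1 - Real.exp (-p i * t))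

/-- The probability that exponential clocks of rates `p i`, `i ∈ S`, all ring before an independent
one of rate `T`. -/
noncomputable def expIntegral (T : ℝ) (p : ι → ℝ) (S : Finset ι) : ℝ :=
  ∫ t in Set.Ioi (0 : ℝ), expIntegrand T p S t

lemma one_sub_exp_mem {a t : ℝ} (ha : 0 ≤ a) (ht : 0 ≤ t) :
    1 - Real.exp (-a * t) ∈ Set.Icc (0 : ℝ) 1 := by
  have h1 : Real.exp (-a * t) ≤ 1 := Real.exp_le_one_iff.2 (by nlinarith)
  have h2 := Real.exp_pos (-a * t)
  constructor <;> linarith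

omit [DecidableEq ι] in
lemma prod_one_sub_exp_mem {p : ι → ℝ} {S : Finset ι} (hp : ∀ i ∈ S, 0 ≤ p i) {t : ℝ}
    (ht : 0 ≤ t) : ∏ i ∈ S, (1 - Real.exp (-p i * t)) ∈ Set.Icc (0 : ℝ) 1 :=
  ⟨Finset.prod_nonneg fun i hi => (one_sub_exp_mem (hp i hi) ht).1,
    Finset.prod_le_one (fun i hi => (one_sub_exp_mem (hp i hi) ht).1)
      fun i hi => (one_sub_exp_mem (hp i hi) ht).2⟩

omit [DecidableEq ι] in
lemma expIntegrand_nonneg {T : ℝ} (hT : 0 ≤ T) {p : ι → ℝ} {S : Finset ι}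
    (hp : ∀ i ∈ S, 0 ≤ p i) {t : ℝ} (ht : 0 ≤ t) : 0 ≤ expIntegrand T p S t :=
  mul_nonneg (mul_nonneg hT (Real.exp_pos _).le) (prod_one_sub_exp_mem hp ht).1

omit [DecidableEq ι] in
@[fun_prop]
lemma continuous_expIntegrand (T : ℝ) (p : ι → ℝ) (S : Finset ι) :
    Continuous (expIntegrand T p S) := by
  unfold expIntegrand
  fun_prop

omit [DecidableEq ι] in
lemma integrableOn_expIntegrand {T : ℝ} (hT : 0 < T) {p : ι → ℝ} {S : Finset ι}
    (hp : ∀ i ∈ S, 0 ≤ p i) : IntegrableOn (expIntegrand T p S) (Set.Ioi 0) := by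
  refine Integrable.mono' ((exp_neg_integrableOn_Ioi 0 hT).const_mul T)
    (continuous_expIntegrand T p S).aestronglyMeasurable ?_
  refine (ae_restrict_iff' measurableSet_Ioi).2 (ae_of_all _ fun t ht => ?_)
  rw [Real.norm_of_nonneg (expIntegrand_nonneg hT.le hp (le_of_lt ht))]
  exact mul_le_of_le_one_right (by positivity) (prod_one_sub_exp_mem hp (le_of_lt ht)).2

omit [DecidableEq ι] in
lemma expIntegral_empty {T : ℝ} (hT : 0 < T) (p : ι → ℝ) : expIntegral T p ∅ = 1 := by
  simp only [expIntegral, expIntegrand, Finset.prod_empty, mul_one]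
  rw [integral_const_mul, integral_exp_mul_Ioi (by linarith)]
  field_simp
  simp

/-- Writing the factor `exp (-p a * t)` of each derivative as `1 - (1 - exp (-p a * t))` leaves only
products over `S.erase a` and over `S`, so the recursion for `expIntegral` closes. -/
lemma hasDerivAt_prod_one_sub_exp (p : ι → ℝ) (S : Finset ι) (t : ℝ) :
    HasDerivAt (fun t => ∏ i ∈ S, (1 - Real.exp (-p i * t)))
      (∑ a ∈ S, p a * ∏ i ∈ S.erase a, (1 - Real.exp (-p i * t)) -
        (∑ a ∈ S, p a) * ∏ i ∈ S, (1 - Real.exp (-p i * t))) t := by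
  have h1 : ∀ i ∈ S, HasDerivAt (fun t => 1 - Real.exp (-p i * t))
      (p i * Real.exp (-p i * t)) t := fun i _ => by
    exact ((((hasDerivAt_id' t).const_mul (-p i)).exp).const_sub 1).congr_deriv (by ring)
  refine (HasDerivAt.fun_finsetProd h1).congr_deriv ?_
  rw [Finset.sum_mul, ← Finset.sum_sub_distrib]
  refine Finset.sum_congr rfl fun a ha => ?_
  rw [← Finset.mul_prod_erase S _ ha, smul_eq_mul]
  ring

/-- The recursion for `expIntegral` given by the first clock to ring. -/
lemma expIntegral_recursion {T : ℝ} (hT : 0 < T) {p : ι → ℝ} {S : Finset ι}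
    (hp : ∀ i ∈ S, 0 ≤ p i) (hS : S.Nonempty) :
    (T + ∑ i ∈ S, p i) * expIntegral T p S = ∑ a ∈ S, p a * expIntegral T p (S.erase a) := by
  have hp' : ∀ a ∈ S, ∀ i ∈ S.erase a, 0 ≤ p i := fun a _ i hi => hp i (Finset.mem_of_mem_erase hi)
  have hderiv : ∀ t ∈ Set.Ici (0 : ℝ), HasDerivAt (expIntegrand T p S)
      (∑ a ∈ S, p a * expIntegrand T p (S.erase a) t -
        (T + ∑ i ∈ S, p i) * expIntegrand T p S t) t := fun t _ => by
    have h1 : HasDerivAt (fun t => T * Real.exp (-T * t)) (-T * (T * Real.exp (-T * t))) t := by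
      exact (((hasDerivAt_id' t).const_mul (-T)).exp.const_mul T).congr_deriv (by ring)
    refine (h1.mul (hasDerivAt_prod_one_sub_exp p S t)).congr_deriv ?_
    simp only [expIntegrand, mul_sub, Finset.mul_sum]
    rw [← sub_eq_zero]
    simp only [mul_left_comm, mul_assoc]
    ring
  have hint1 : IntegrableOn (fun t => ∑ a ∈ S, p a * expIntegrand T p (S.erase a) t)
      (Set.Ioi 0) :=
    integrable_finsetSum _ fun a ha => (integrableOn_expIntegrand hT (hp' a ha)).const_mul _
  have hint2 : IntegrableOn (fun t => (T + ∑ i ∈ S, p i) * expIntegrand T p S t) (Set.Ioi 0) :=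
    (integrableOn_expIntegrand hT hp).const_mul _
  have hlim : Tendsto (expIntegrand T p S) atTop (𝓝 0) := by
    have h0 : Tendsto (fun t : ℝ => T * Real.exp (-T * t)) atTop (𝓝 0) := by
      have : Tendsto (fun t : ℝ => -T * t) atTop atBot :=
        tendsto_id.const_mul_atTop_of_neg (by linarith)
      simpa using (Real.tendsto_exp_atBot.comp this).const_mul T
    refine squeeze_zero' ?_ ?_ h0
    · filter_upwards [eventually_ge_atTop 0] with t ht
      exact expIntegrand_nonneg hT.le hp ht
    · filter_upwards [eventually_ge_atTop 0] with t ht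
      exact mul_le_of_le_one_right (by positivity) (prod_one_sub_exp_mem hp ht).2
  have hmain := integral_Ioi_of_hasDerivAt_of_tendsto' hderiv (hint1.sub hint2) hlim
  have hzero : expIntegrand T p S 0 = 0 := by
    obtain ⟨a, ha⟩ := hS
    have : ∏ i ∈ S, (1 - Real.exp (-p i * 0)) = 0 := Finset.prod_eq_zero ha (by simp)
    rw [expIntegrand, this, mul_zero]
  rw [integral_sub hint1 hint2, integral_finsetSum _ fun a ha =>
    (integrableOn_expIntegrand hT (hp' a ha)).const_mul _, hzero, sub_zero,
    sub_eq_zero, integral_const_mul] at hmain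
  simp only [integral_const_mul] at hmain
  exact hmain.symm

/-- The probability that all the sets `J i`, `i ∈ S`, are visited before the first exit from
`⋃ i ∈ K, J i`. -/
lemma infinitePi_real_hitSet_eq_expIntegral {α : Type*} [MeasurableSpace α]
    (ν : Measure α) [IsProbabilityMeasure ν] {J : ι → Set α}
    (hJ : ∀ i, MeasurableSet (J i)) (hd : Pairwise (Function.onFun Disjoint J))
    {K : Finset ι} {T : ℝ} (hT : 0 < T) (hTK : T + ∑ i ∈ K, ν.real (J i) = 1)
    (S : Finset ι) (hSK : S ⊆ K) :
    (Measure.infinitePi fun _ : ℕ => ν).real (hitSet J K S) =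
      expIntegral T (fun i => ν.real (J i)) S := by
  induction S using Finset.strongInduction with
  | H S ih =>
    rcases S.eq_empty_or_nonempty with rfl | hS
    · rw [expIntegral_empty hT]
      have : hitSet J K ∅ = Set.univ := by
        ext x
        simp [hitSet]
      rw [this, probReal_univ]
    · have h1 := infinitePi_real_hitSet ν hJ hd (K := K) hS
      have h2 := expIntegral_recursion hT (p := fun i => ν.real (J i)) (S := S)
        (fun i _ => measureReal_nonneg) hS
      -- A sample in `J i` with `i ∈ K \ S` erases nothing from `S`. Those terms reproduce the
      -- unknown itself and are moved to the left side, where the coefficient becomes `T + ∑ i ∈ S`.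
      rw [← Finset.sum_sdiff hSK] at h1 hTK
      have h3 : ∑ i ∈ K \ S, ν.real (J i) *
          (Measure.infinitePi fun _ : ℕ => ν).real (hitSet J K (S.erase i)) =
          (∑ i ∈ K \ S, ν.real (J i)) *
            (Measure.infinitePi fun _ : ℕ => ν).real (hitSet J K S) := by
        rw [Finset.sum_mul]
        refine Finset.sum_congr rfl fun i hi => ?_
        rw [Finset.erase_eq_of_notMem (Finset.mem_sdiff.1 hi).2]
      have h4 : ∑ i ∈ S, ν.real (J i) *
          (Measure.infinitePi fun _ : ℕ => ν).real (hitSet J K (S.erase i)) =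
          ∑ i ∈ S, ν.real (J i) * expIntegral T (fun i => ν.real (J i)) (S.erase i) :=
        Finset.sum_congr rfl fun i hi => by
          rw [ih _ (Finset.erase_ssubset hi) ((Finset.erase_subset _ _).trans hSK)]
      rw [h3, h4, ← h2] at h1
      have hpos : 0 < T + ∑ i ∈ S, ν.real (J i) :=
        add_pos_of_pos_of_nonneg hT (Finset.sum_nonneg fun i _ => measureReal_nonneg)
      refine mul_left_cancel₀ hpos.ne' ?_
      linear_combination h1 + (Measure.infinitePi fun _ : ℕ => ν).real (hitSet J K S) * hTK

end ExpIntegral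

/-! ### The sum over permutations -/

/-- The sum over all orders of discovery as an exponential integral. -/
lemma sum_perm_prod_eq_expIntegral {T : ℝ} (hT : 0 < T) (k : ℕ) (p : Fin k → ℝ)
    (hp : ∀ i, 0 ≤ p i) :
    ∑ π : Equiv.Perm (Fin k), ∏ i, p (π i) / (T + ∑ j, p j - ∑ j ∈ Finset.Iio i, p (π j)) =
      expIntegral T p Finset.univ := by
  induction k with
  | zero => simp [expIntegral_empty hT]
  | succ k ih =>
    -- `i ↦ swap 0 a i.succ` enumerates all indices other than `a`. The monoid is general so that
    -- `Multiplicative ℝ` also yields the additive version `hsum`.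
    have hprod : ∀ {M : Type} [CommMonoid M] (g : Fin (k + 1) → M) (a : Fin (k + 1)),
        ∏ i : Fin k, g (Equiv.swap 0 a i.succ) = ∏ i ∈ Finset.univ.erase a, g i := by
      intro M _ g a
      refine Finset.prod_bij (fun i _ => Equiv.swap 0 a i.succ) ?_ ?_ ?_ ?_
      · intro i _
        refine Finset.mem_erase.2 ⟨fun h => ?_, Finset.mem_univ _⟩
        have h' := congrArg (Equiv.swap 0 a) h
        rw [Equiv.swap_apply_self, Equiv.swap_apply_right] at h'
        exact Fin.succ_ne_zero _ h'
      · intro i _ j _ h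
        exact Fin.succ_injective _ ((Equiv.swap 0 a).injective h)
      · intro i hi
        have h0 : Equiv.swap 0 a i ≠ 0 := fun h => by
          have h' := congrArg (Equiv.swap 0 a) h
          rw [Equiv.swap_apply_self, Equiv.swap_apply_left] at h'
          exact (Finset.mem_erase.1 hi).1 h'
        obtain ⟨j, hj⟩ := Fin.exists_succ_eq.2 h0
        exact ⟨j, Finset.mem_univ _, by rw [hj, Equiv.swap_apply_self]⟩
      · intro i _
        rfl
    have hsum : ∀ a : Fin (k + 1),
        ∑ i : Fin k, p (Equiv.swap 0 a i.succ) = ∑ i, p i - p a := fun a => by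
      have := hprod (M := Multiplicative ℝ) (fun i => Multiplicative.ofAdd (p i)) a
      rw [← ofAdd_sum, ← ofAdd_sum] at this
      rw [Multiplicative.ofAdd.injective this, ← Finset.add_sum_erase _ p (Finset.mem_univ a)]
      ring
    have hpos : 0 < T + ∑ i, p i :=
      add_pos_of_pos_of_nonneg hT (Finset.sum_nonneg fun i _ => hp i)
    -- Split the permutations by their first value `a`, that is, by the stick discovered first.
    rw [← Equiv.Perm.decomposeFin.symm.sum_comp, Fintype.sum_prod_type]
    have hterm : ∀ a : Fin (k + 1), ∑ e : Equiv.Perm (Fin k), ∏ i : Fin (k + 1),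
        p (Equiv.Perm.decomposeFin.symm (a, e) i) / (T + ∑ j, p j -
          ∑ j ∈ Finset.Iio i, p (Equiv.Perm.decomposeFin.symm (a, e) j)) =
        p a / (T + ∑ j, p j) * expIntegral T p (Finset.univ.erase a) := fun a => by
      have hD : expIntegral T p (Finset.univ.erase a) =
          expIntegral T (fun i : Fin k => p (Equiv.swap 0 a i.succ)) Finset.univ := by
        refine congrArg (fun f : ℝ → ℝ => ∫ t in Set.Ioi 0, f t) (funext fun t => ?_)
        rw [expIntegrand, expIntegrand, hprod (fun i => 1 - Real.exp (-p i * t)) a]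
      rw [hD, ← ih (fun i => p (Equiv.swap 0 a i.succ)) (fun i => hp _), Finset.mul_sum]
      refine Finset.sum_congr rfl fun e _ => ?_
      rw [Fin.prod_univ_succ]
      congr 1
      · have : Finset.Iio (0 : Fin (k + 1)) = ∅ := by
          ext x
          simp
        simp [this]
      · refine Finset.prod_congr rfl fun i _ => ?_
        have hIio : Finset.Iio i.succ = insert 0 ((Finset.Iio i).map (Fin.succEmb k)) := by
          ext x
          refine Fin.cases ?_ (fun x => ?_) x
          · simp
          · simp
        rw [hIio, Finset.sum_insert (by simp), Finset.sum_map]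
        simp only [Equiv.Perm.decomposeFin_symm_apply_succ,
          Equiv.Perm.decomposeFin_symm_apply_zero, Fin.coe_succEmb, hsum]
        congr 1
        ring
    rw [Finset.sum_congr rfl fun a _ => hterm a]
    refine mul_left_cancel₀ hpos.ne' ?_
    rw [expIntegral_recursion hT (fun i _ => hp i) Finset.univ_nonempty, Finset.mul_sum]
    refine Finset.sum_congr rfl fun a _ => ?_
    field_simp

/-! ### Eigenfunctions of the stick-breaking operator -/

section Eigenfunctions

open Filter Topology

lemma lintegral_Ioi_of_hasDerivAt_of_nonneg {g g' : ℝ → ℝ} {a l : ℝ}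
    (hderiv : ∀ x ∈ Set.Ici a, HasDerivAt g (g' x) x) (hpos : ∀ x ∈ Set.Ioi a, 0 ≤ g' x)
    (hlim : Tendsto g atTop (𝓝 l)) :
    ∫⁻ x in Set.Ioi a, ENNReal.ofReal (g' x) = ENNReal.ofReal (l - g a) := by
  rw [← integral_Ioi_of_hasDerivAt_of_nonneg' hderiv hpos hlim,
    ofReal_integral_eq_lintegral_ofReal (integrableOn_Ioi_deriv_of_nonneg' hderiv hpos hlim)]
  exact (ae_restrict_iff' measurableSet_Ioi).2 (ae_of_all _ hpos)

lemma tendsto_exp_neg_mul_atTop {c : ℝ} (hc : 0 < c) :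
    Tendsto (fun t : ℝ => Real.exp (-c * t)) atTop (𝓝 0) :=
  Real.tendsto_exp_atBot.comp (tendsto_id.const_mul_atTop_of_neg (by linarith))

lemma hasDerivAt_exp_neg_mul (c t : ℝ) :
    HasDerivAt (fun t => Real.exp (-c * t)) (-c * Real.exp (-c * t)) t :=
  (((hasDerivAt_id' t).const_mul (-c)).exp).congr_deriv (by ring)

lemma lintegral_exp_neg_mul {c : ℝ} (hc : 0 < c) :
    ∫⁻ t in Set.Ioi (0 : ℝ), ENNReal.ofReal (c * Real.exp (-c * t)) = 1 := by
  rw [lintegral_Ioi_of_hasDerivAt_of_nonneg (g := fun t => -Real.exp (-c * t)) (l := 0)]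
  · simp
  · intro t _
    exact (hasDerivAt_exp_neg_mul c t).neg.congr_deriv (by ring)
  · intro t _
    positivity
  · simpa using (tendsto_exp_neg_mul_atTop hc).neg

lemma lintegral_mul_exp_neg_mul {c : ℝ} (hc : 0 < c) :
    ∫⁻ t in Set.Ioi (0 : ℝ), ENNReal.ofReal (t * Real.exp (-c * t)) =
      ENNReal.ofReal (1 / c ^ 2) := by
  have hlim : Tendsto
      (fun t : ℝ => -((c * t) ^ 1 * Real.exp (-(c * t)) + Real.exp (-c * t)) / c ^ 2) atTop
      (𝓝 (-(0 + 0) / c ^ 2)) :=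
    ((((Real.tendsto_pow_mul_exp_neg_atTop_nhds_zero 1).comp
      (tendsto_id.const_mul_atTop hc)).add (tendsto_exp_neg_mul_atTop hc)).neg).div_const _
  rw [lintegral_Ioi_of_hasDerivAt_of_nonneg
    (g := fun t => -((c * t) * Real.exp (-c * t) + Real.exp (-c * t)) / c ^ 2) (l := 0)]
  · congr 1
    simp
    ring
  · intro t _
    refine ((((((hasDerivAt_id' t).const_mul c).mul (hasDerivAt_exp_neg_mul c t)).add
      (hasDerivAt_exp_neg_mul c t)).neg).div_const (c ^ 2)).congr_deriv ?_
    field_simp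
    ring
  · intro t ht
    exact mul_nonneg (le_of_lt ht) (Real.exp_pos _).le
  · simpa using hlim

/-- The factor `1 - exp (-(t - s))` of the kernel, integrated in `t`, maps `exp (-r * t)` to a
multiple of `exp (-r * s)`. This is why the eigenfunctions are sought as mixtures of exponentials.
-/
lemma lintegral_one_sub_exp_mul_exp {r s : ℝ} (hr : 0 < r) :
    ∫⁻ t in Set.Ioi s, ENNReal.ofReal ((1 - Real.exp (-(t - s))) * Real.exp (-r * t)) =
      ENNReal.ofReal (Real.exp (-r * s) / (r * (r + 1))) := by
  have hlim : Tendsto (fun t : ℝ => Real.exp s * Real.exp (-(r + 1) * t) / (r + 1) -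
      Real.exp (-r * t) / r) atTop (𝓝 (Real.exp s * 0 / (r + 1) - 0 / r)) :=
    (((tendsto_exp_neg_mul_atTop (by linarith)).const_mul _).div_const _).sub
      ((tendsto_exp_neg_mul_atTop hr).div_const _)
  have hsplit : ∀ t, Real.exp s * Real.exp (-(r + 1) * t) =
      Real.exp (-(t - s)) * Real.exp (-r * t) := fun t => by
    rw [← Real.exp_add, ← Real.exp_add]
    congr 1
    ring
  rw [lintegral_Ioi_of_hasDerivAt_of_nonneg (g := fun t : ℝ =>
    Real.exp s * Real.exp (-(r + 1) * t) / (r + 1) - Real.exp (-r * t) / r) (l := 0)]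
  · congr 1
    simp only [hsplit]
    simp
    field_simp
    ring
  · intro t _
    refine ((((hasDerivAt_exp_neg_mul (r + 1) t).const_mul (Real.exp s)).div_const (r + 1)).sub
      ((hasDerivAt_exp_neg_mul r t).div_const r)).congr_deriv ?_
    rw [sub_mul, ← hsplit]
    field_simp
    ring
  · intro t ht
    have : Real.exp (-(t - s)) ≤ 1 := Real.exp_le_one_iff.2 (by linarith [Set.mem_Ioi.1 ht])
    exact mul_nonneg (by linarith) (Real.exp_pos _).le
  · simpa using hlim

/-- The integral kernel of the operator which adds a stick. -/
noncomputable def stickKernel (t s : ℝ) : ℝ := s * (1 - Real.exp (-(t - s))) / t ^ 2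

/-- The integrand of `eigenfunction`. -/
noncomputable def eigenIntegrand (n : ℕ) (t r : ℝ) : ℝ :=
  t * Real.exp (-r * t) * ((r / (1 + r)) ^ n / (1 + r) ^ 2)

/-- The eigenfunction of the transpose of `stickKernel` with eigenvalue `1 / (n + 1)`. -/
noncomputable def eigenfunction (n : ℕ) (t : ℝ) : ENNReal :=
  ∫⁻ r in Set.Ioi (0 : ℝ), ENNReal.ofReal (eigenIntegrand n t r)

lemma measurable_stickKernel : Measurable (Function.uncurry stickKernel) := by
  unfold stickKernel Function.uncurry
  fun_prop

lemma measurable_eigenIntegrand (n : ℕ) : Measurable (Function.uncurry (eigenIntegrand n)) := by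
  unfold eigenIntegrand Function.uncurry
  fun_prop

lemma measurable_eigenfunction (n : ℕ) : Measurable (eigenfunction n) :=
  Measurable.lintegral_prod_right' (f := fun q : ℝ × ℝ => ENNReal.ofReal (eigenIntegrand n q.1 q.2))
    (measurable_eigenIntegrand n).ennreal_ofReal

lemma hasDerivAt_div_one_add {r : ℝ} (hr : 0 ≤ r) :
    HasDerivAt (fun r : ℝ => r / (1 + r)) (1 / (1 + r) ^ 2) r := by
  have h : 1 + r ≠ 0 := by positivity
  refine ((hasDerivAt_id' r).div ((hasDerivAt_id' r).const_add 1) h).congr_deriv ?_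
  field_simp
  ring

lemma div_one_add_mem {r : ℝ} (hr : 0 ≤ r) : r / (1 + r) ∈ Set.Ico (0 : ℝ) 1 :=
  ⟨by positivity, (div_lt_one (by positivity)).2 (by linarith)⟩

/-- Integration by parts in the definition of `eigenfunction`. -/
lemma eigenfunction_eq (n : ℕ) {t : ℝ} (ht : 0 < t) :
    eigenfunction n t = ∫⁻ r in Set.Ioi (0 : ℝ),
      ENNReal.ofReal (t ^ 2 / (n + 1) * Real.exp (-r * t) * (r / (1 + r)) ^ (n + 1)) := by
  have hexp : IntegrableOn (fun r : ℝ => Real.exp (-t * r)) (Set.Ioi 0) :=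
    exp_neg_integrableOn_Ioi 0 ht
  have hcomm : ∀ r : ℝ, Real.exp (-r * t) = Real.exp (-t * r) := fun r => by
    congr 1
    ring
  have hcont : ContinuousOn (fun r : ℝ => r / (1 + r)) (Set.Ioi 0) := fun r hr =>
    (hasDerivAt_div_one_add (le_of_lt hr)).continuousAt.continuousWithinAt
  have hcont2 : ContinuousOn (fun r : ℝ => (1 + r) ^ 2) (Set.Ioi 0) := by fun_prop
  have hne : ∀ r ∈ Set.Ioi (0 : ℝ), (1 + r) ^ 2 ≠ 0 := fun r hr => by
    have := Set.mem_Ioi.1 hr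
    positivity
  have hcexp : ContinuousOn (fun r : ℝ => Real.exp (-r * t)) (Set.Ioi 0) := by fun_prop
  have hnn1 : ∀ r ∈ Set.Ioi (0 : ℝ), 0 ≤ eigenIntegrand n t r := fun r hr => by
    have := Set.mem_Ioi.1 hr
    unfold eigenIntegrand
    positivity
  have hnn2 : ∀ r ∈ Set.Ioi (0 : ℝ),
      0 ≤ t ^ 2 / (n + 1) * Real.exp (-r * t) * (r / (1 + r)) ^ (n + 1) := fun r hr => by
    have := Set.mem_Ioi.1 hr
    positivity
  have hint1 : IntegrableOn (eigenIntegrand n t) (Set.Ioi 0) := by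
    refine Integrable.mono' (hexp.const_mul t) (ContinuousOn.aestronglyMeasurable
      ((hcexp.const_mul t).mul ((hcont.pow n).div hcont2 hne)) measurableSet_Ioi) ?_
    refine (ae_restrict_iff' measurableSet_Ioi).2 (ae_of_all _ fun r hr => ?_)
    rw [Real.norm_of_nonneg (hnn1 r hr), eigenIntegrand, hcomm]
    have h0 := Set.mem_Ioi.1 hr
    have h1 : (r / (1 + r)) ^ n ≤ 1 :=
      pow_le_one₀ (div_one_add_mem h0.le).1 (div_one_add_mem h0.le).2.le
    refine mul_le_of_le_one_right (by positivity) (div_le_one_of_le₀ ?_ (by positivity))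
    nlinarith
  have hint2 : IntegrableOn
      (fun r : ℝ => t ^ 2 / (n + 1) * Real.exp (-r * t) * (r / (1 + r)) ^ (n + 1))
      (Set.Ioi 0) := by
    refine Integrable.mono' (hexp.const_mul (t ^ 2 / (n + 1))) (ContinuousOn.aestronglyMeasurable
      ((hcexp.const_mul (t ^ 2 / (n + 1))).mul (hcont.pow (n + 1))) measurableSet_Ioi) ?_
    refine (ae_restrict_iff' measurableSet_Ioi).2 (ae_of_all _ fun r hr => ?_)
    rw [Real.norm_of_nonneg (hnn2 r hr), hcomm]
    have h0 := Set.mem_Ioi.1 hr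
    exact mul_le_of_le_one_right (by positivity)
      (pow_le_one₀ (div_one_add_mem h0.le).1 (div_one_add_mem h0.le).2.le)
  -- With `y = r / (1 + r)` one has `dy = dr / (1 + r)^2`, so `y^(n+1) / (n + 1)` is the
  -- antiderivative of the rational factor. The boundary terms vanish at `0` through `y^(n+1)` and
  -- at infinity through the exponential.
  have hderiv : ∀ r ∈ Set.Ici (0 : ℝ), HasDerivAt
      (fun r : ℝ => t / (n + 1) * Real.exp (-t * r) * (r / (1 + r)) ^ (n + 1))
      (eigenIntegrand n t r - t ^ 2 / (n + 1) * Real.exp (-r * t) * (r / (1 + r)) ^ (n + 1)) r :=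
    fun r hr => by
      refine (((hasDerivAt_exp_neg_mul t r).const_mul (t / (n + 1))).mul
        ((hasDerivAt_div_one_add hr).pow (n + 1))).congr_deriv ?_
      rw [eigenIntegrand, hcomm]
      have h1 : (n + 1 : ℝ) ≠ 0 := by positivity
      have h2 : (1 + r) ≠ 0 := by
        have := Set.mem_Ici.1 hr
        positivity
      simp only [Nat.add_sub_cancel, Pi.pow_apply]
      push_cast
      field_simp
      ring
  have hlim : Tendsto (fun r : ℝ => t / (n + 1) * Real.exp (-t * r) * (r / (1 + r)) ^ (n + 1))
      atTop (𝓝 0) := by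
    have h0 : Tendsto (fun r : ℝ => t / (n + 1) * Real.exp (-t * r)) atTop (𝓝 0) := by
      simpa using (tendsto_exp_neg_mul_atTop ht).const_mul (t / (n + 1))
    refine squeeze_zero' ?_ ?_ h0
    · filter_upwards [eventually_ge_atTop 0] with r hr
      positivity
    · filter_upwards [eventually_ge_atTop 0] with r hr
      exact mul_le_of_le_one_right (by positivity)
        (pow_le_one₀ (div_one_add_mem hr).1 (div_one_add_mem hr).2.le)
  have hmain := integral_Ioi_of_hasDerivAt_of_tendsto' hderiv (hint1.sub hint2) hlim
  rw [integral_sub hint1 hint2] at hmain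
  simp only [zero_div, ne_eq, Nat.add_eq_zero_iff, one_ne_zero, and_false, not_false_eq_true,
    zero_pow, mul_zero, sub_zero, sub_eq_zero] at hmain
  rw [eigenfunction, ← ofReal_integral_eq_lintegral_ofReal hint1
      ((ae_restrict_iff' measurableSet_Ioi).2 (ae_of_all _ hnn1)),
    ← ofReal_integral_eq_lintegral_ofReal hint2
      ((ae_restrict_iff' measurableSet_Ioi).2 (ae_of_all _ hnn2)), hmain]

lemma stickKernel_nonpos {s t : ℝ} (hs : 0 ≤ s) (hts : t ≤ s) : stickKernel t s ≤ 0 := by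
  have : 1 ≤ Real.exp (-(t - s)) := Real.one_le_exp (by linarith)
  exact div_nonpos_of_nonpos_of_nonneg (mul_nonpos_of_nonneg_of_nonpos hs (by linarith))
    (by positivity)

/-- In the form of `eigenfunction_eq`, the factor `t^2` cancels the denominator of the kernel. The
inner integral over `t` then gives `1 / (r * (r + 1))`, which turns `(r / (1 + r))^(n+1)` back into
`(r / (1 + r))^n / (1 + r)^2`. -/
lemma lintegral_stickKernel_mul_eigenfunction (n : ℕ) {s : ℝ} (hs : 0 < s) :
    ∫⁻ t in Set.Ioi (0 : ℝ), ENNReal.ofReal (stickKernel t s) * eigenfunction n t =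
      ENNReal.ofReal (1 / (n + 1)) * eigenfunction n s := by
  have h1 : ∫⁻ t in Set.Ioi (0 : ℝ), ENNReal.ofReal (stickKernel t s) * eigenfunction n t =
      ∫⁻ t in Set.Ioi s, ENNReal.ofReal (stickKernel t s) * eigenfunction n t := by
    rw [← lintegral_indicator measurableSet_Ioi, ← lintegral_indicator measurableSet_Ioi]
    refine lintegral_congr fun t => ?_
    by_cases hst : s < t
    · rw [Set.indicator_of_mem (Set.mem_Ioi.2 (hs.trans hst)),
        Set.indicator_of_mem (Set.mem_Ioi.2 hst)]
    · rw [Set.indicator_of_notMem (s := Set.Ioi s) (by simpa using hst),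
        Set.indicator_apply_eq_zero]
      intro _
      -- `ENNReal.ofReal` truncates the kernel to `s < t`, so no indicator is needed in its
      -- definition.
      rw [ENNReal.ofReal_of_nonpos (stickKernel_nonpos hs.le (not_lt.1 hst)), zero_mul]
  have h2 : ∀ t ∈ Set.Ioi s, ENNReal.ofReal (stickKernel t s) * eigenfunction n t =
      ∫⁻ r in Set.Ioi (0 : ℝ), ENNReal.ofReal (s / (n + 1) * (r / (1 + r)) ^ (n + 1)) *
        ENNReal.ofReal ((1 - Real.exp (-(t - s))) * Real.exp (-r * t)) := fun t ht => by
    have hst := Set.mem_Ioi.1 ht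
    have ht0 : 0 < t := hs.trans hst
    rw [eigenfunction_eq n ht0, ← lintegral_const_mul' _ _ ENNReal.ofReal_ne_top]
    refine setLIntegral_congr_fun measurableSet_Ioi fun r hr => ?_
    have hr0 := Set.mem_Ioi.1 hr
    have he : Real.exp (-(t - s)) ≤ 1 := Real.exp_le_one_iff.2 (by linarith)
    have hk : 0 ≤ stickKernel t s :=
      div_nonneg (mul_nonneg hs.le (by linarith)) (by positivity)
    rw [← ENNReal.ofReal_mul hk, ← ENNReal.ofReal_mul (by positivity), stickKernel]
    congr 1
    field_simp
  rw [h1, setLIntegral_congr_fun measurableSet_Ioi h2, lintegral_lintegral_swap, eigenfunction,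
    ← lintegral_const_mul' _ _ ENNReal.ofReal_ne_top]
  · refine setLIntegral_congr_fun measurableSet_Ioi fun r hr => ?_
    have hr0 := Set.mem_Ioi.1 hr
    rw [lintegral_const_mul' _ _ ENNReal.ofReal_ne_top, lintegral_one_sub_exp_mul_exp hr0,
      ← ENNReal.ofReal_mul (by positivity), ← ENNReal.ofReal_mul (by positivity), eigenIntegrand]
    congr 1
    rw [add_comm r 1, pow_succ]
    field_simp
  · refine Measurable.aemeasurable ?_
    unfold Function.uncurry
    fun_prop

lemma lintegral_exp_mul_eigenfunction (n : ℕ) :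
    ∫⁻ t in Set.Ioi (0 : ℝ), ENNReal.ofReal (Real.exp (-t)) * eigenfunction n t =
      ENNReal.ofReal (2 / ((n + 1) * (n + 2) * (n + 3))) := by
  have h1 : ∀ t ∈ Set.Ioi (0 : ℝ), ENNReal.ofReal (Real.exp (-t)) * eigenfunction n t =
      ∫⁻ r in Set.Ioi (0 : ℝ), ENNReal.ofReal ((r / (1 + r)) ^ n / (1 + r) ^ 2) *
        ENNReal.ofReal (t * Real.exp (-(1 + r) * t)) := fun t ht => by
    rw [eigenfunction, ← lintegral_const_mul' _ _ ENNReal.ofReal_ne_top]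
    refine setLIntegral_congr_fun measurableSet_Ioi fun r hr => ?_
    have hr0 := Set.mem_Ioi.1 hr
    rw [← ENNReal.ofReal_mul (by positivity), ← ENNReal.ofReal_mul (by positivity),
      eigenIntegrand]
    have : Real.exp (-(1 + r) * t) = Real.exp (-t) * Real.exp (-r * t) := by
      rw [← Real.exp_add]
      congr 1
      ring
    rw [this]
    congr 1
    ring
  rw [setLIntegral_congr_fun measurableSet_Ioi h1, lintegral_lintegral_swap]
  · have h2 : ∀ r ∈ Set.Ioi (0 : ℝ), ∫⁻ t in Set.Ioi (0 : ℝ),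
        ENNReal.ofReal ((r / (1 + r)) ^ n / (1 + r) ^ 2) *
          ENNReal.ofReal (t * Real.exp (-(1 + r) * t)) =
        ENNReal.ofReal ((r / (1 + r)) ^ n / (1 + r) ^ 4) := fun r hr => by
      have hr0 := Set.mem_Ioi.1 hr
      rw [lintegral_const_mul' _ _ ENNReal.ofReal_ne_top,
        lintegral_mul_exp_neg_mul (by positivity), ← ENNReal.ofReal_mul (by positivity)]
      congr 1
      field_simp
    rw [setLIntegral_congr_fun measurableSet_Ioi h2]
    have hy : Tendsto (fun r : ℝ => r / (1 + r)) atTop (𝓝 1) := by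
      have h : Tendsto (fun r : ℝ => 1 - (1 + r)⁻¹) atTop (𝓝 (1 - 0)) :=
        (tendsto_inv_atTop_zero.comp (tendsto_atTop_add_const_left _ 1 tendsto_id)).const_sub 1
      rw [sub_zero] at h
      refine h.congr' ?_
      filter_upwards [eventually_ge_atTop 0] with r hr
      field_simp
      ring
    have hlim := (((hy.pow (n + 1)).div_const ((n : ℝ) + 1)).sub
      (((hy.pow (n + 2)).const_mul 2).div_const ((n : ℝ) + 2))).add
        ((hy.pow (n + 3)).div_const ((n : ℝ) + 3))
    -- In the variable `y = r / (1 + r)` this is the Beta integral of `y^n * (1 - y)^2` over `(0,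
    -- 1)`; `g` is its expanded antiderivative.
    rw [lintegral_Ioi_of_hasDerivAt_of_nonneg (g := fun r : ℝ =>
      (r / (1 + r)) ^ (n + 1) / (n + 1) - 2 * (r / (1 + r)) ^ (n + 2) / (n + 2) +
        (r / (1 + r)) ^ (n + 3) / (n + 3)) _ _ hlim]
    · congr 1
      simp
      field_simp
      ring
    · intro r hr
      have hr0 := Set.mem_Ici.1 hr
      have hd := hasDerivAt_div_one_add hr0
      refine ((((hd.pow (n + 1)).div_const ((n : ℝ) + 1)).sub
        (((hd.pow (n + 2)).const_mul 2).div_const ((n : ℝ) + 2))).add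
        ((hd.pow (n + 3)).div_const ((n : ℝ) + 3))).congr_deriv ?_
      have e1 : n + 1 - 1 = n := rfl
      have e2 : n + 2 - 1 = n + 1 := rfl
      have e3 : n + 3 - 1 = n + 2 := rfl
      have e4 : 1 / (1 + r) ^ 4 = 1 / (1 + r) ^ 2 * (1 - r / (1 + r)) ^ 2 := by
        field_simp
        ring
      rw [e1, e2, e3, div_eq_mul_one_div _ ((1 + r) ^ 4), e4]
      push_cast
      have d1 : (n : ℝ) + 1 ≠ 0 := by positivity
      have d2 : (n : ℝ) + 2 ≠ 0 := by positivity
      have d3 : (n : ℝ) + 3 ≠ 0 := by positivity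
      generalize r / (1 + r) = y
      generalize 1 / (1 + r) ^ 2 = z
      field_simp
      ring
    · intro r hr
      have hr0 := Set.mem_Ioi.1 hr
      positivity
  · refine Measurable.aemeasurable ?_
    unfold Function.uncurry
    fun_prop

/-- The eigenfunction expansion of the constant function `1`. -/
lemma tsum_mul_eigenfunction {t : ℝ} (ht : 0 < t) :
    ∑' n : ℕ, ENNReal.ofReal (n + 1) * eigenfunction n t = 1 := by
  have hm : ∀ n : ℕ, Measurable (eigenIntegrand n t) := fun n =>
    (measurable_eigenIntegrand n).comp measurable_prodMk_left
  simp only [eigenfunction]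
  simp_rw [← lintegral_const_mul' _ _ ENNReal.ofReal_ne_top]
  rw [← lintegral_tsum fun n => ((hm n).ennreal_ofReal.const_mul _).aemeasurable,
    ← lintegral_exp_neg_mul ht]
  refine setLIntegral_congr_fun measurableSet_Ioi fun r hr => ?_
  have hr0 := Set.mem_Ioi.1 hr
  have hnn : ∀ n : ℕ, 0 ≤ ((n : ℝ) + 1) * eigenIntegrand n t r := fun n => by
    unfold eigenIntegrand
    positivity
  have hlt : ‖r / (1 + r)‖ < 1 := by
    rw [Real.norm_of_nonneg (div_one_add_mem hr0.le).1]
    exact (div_one_add_mem hr0.le).2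
  -- The series `∑ (n + 1) y^n = 1 / (1 - y)^2` at `y = r / (1 + r)` equals `(1 + r)^2` and cancels
  -- the denominator. What is left is the exponential density `t * exp (-t * r)` in `r`, of total
  -- mass `1`.
  have hsum := (hasSum_choose_mul_geometric_of_norm_lt_one 1 hlt).mul_left
    (t * Real.exp (-r * t) / (1 + r) ^ 2)
  simp_rw [← ENNReal.ofReal_mul (show ∀ {n : ℕ}, (0 : ℝ) ≤ n + 1 by intro n; positivity)]
  have hs : HasSum (fun n : ℕ => ((n : ℝ) + 1) * eigenIntegrand n t r)
      (t * Real.exp (-t * r)) := by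
    have h1 : 1 - r / (1 + r) = 1 / (1 + r) := by
      field_simp
      ring
    have h2 : t * Real.exp (-t * r) = t * Real.exp (-r * t) / (1 + r) ^ 2 *
        (1 / (1 - r / (1 + r)) ^ (1 + 1)) := by
      rw [h1, neg_mul, neg_mul, mul_comm r t, div_pow, one_pow]
      field_simp
    rw [h2]
    refine hsum.congr_fun fun n => ?_
    simp only [eigenIntegrand, Nat.choose_one_right]
    push_cast
    ring
  rw [← ENNReal.ofReal_tsum_of_nonneg hnn hs.summable, hs.tsum_eq]

end Eigenfunctions

/-! ### Averaging over the stick-breaking factors -/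

lemma stick_cons_zero {k : ℕ} (a : ℝ) (w : Fin k → ℝ) :
    stick (Fin.cons a w : Fin (k + 1) → ℝ) 0 = a := by
  have : Finset.Iio (0 : Fin (k + 1)) = ∅ := by
    ext x
    simp
  simp [stick, this]

lemma stick_cons_succ {k : ℕ} (a : ℝ) (w : Fin k → ℝ) (i : Fin k) :
    stick (Fin.cons a w : Fin (k + 1) → ℝ) i.succ = (1 - a) * stick w i := by
  have hIio : Finset.Iio i.succ = insert 0 ((Finset.Iio i).map (Fin.succEmb k)) := by
    ext x
    refine Fin.cases ?_ (fun x => ?_) x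
    · simp
    · simp
  rw [stick, hIio, Finset.prod_insert (by simp), Finset.prod_map]
  simp [stick, mul_assoc]

lemma measurableSet_openCube (k : ℕ) : MeasurableSet (openCube k) :=
  MeasurableSet.univ_pi fun _ => measurableSet_Ioo

@[fun_prop]
lemma continuous_stick {k : ℕ} (i : Fin k) : Continuous fun w : Fin k → ℝ => stick w i := by
  unfold stick
  fun_prop

lemma setLIntegral_openCube_succ {k : ℕ} {g : (Fin (k + 1) → ℝ) → ENNReal} (hg : Measurable g) :
    ∫⁻ w in openCube (k + 1), g w =
      ∫⁻ a in Set.Ioo (0 : ℝ) 1, ∫⁻ w in openCube k, g (Fin.cons a w) := by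
  have hmp := (volume_preserving_piFinSuccAbove (fun _ : Fin (k + 1) => ℝ) 0).symm
  have hpre : (MeasurableEquiv.piFinSuccAbove (fun _ : Fin (k + 1) => ℝ) 0).symm ⁻¹'
      openCube (k + 1) = Set.Ioo (0 : ℝ) 1 ×ˢ openCube k := by
    ext q
    simp only [openCube, Set.mem_preimage, Set.mem_univ_pi, Set.mem_prod]
    rw [Fin.forall_fin_succ]
    simp
  rw [← hmp.setLIntegral_comp_preimage_emb (MeasurableEquiv.measurableEmbedding _), hpre,
    Measure.volume_eq_prod, setLIntegral_prod _ (by fun_prop)]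
  simp [Fin.consEquiv]

/-- The density of the exponential clock attached to the remaining stick, restricted to the event
that the clocks of the first `k` sticks have rung. -/
noncomputable def clockDensity (k : ℕ) (t : ℝ) : ENNReal :=
  ∫⁻ w in openCube k, ENNReal.ofReal (expIntegrand (∏ i, (1 - w i)) (stick w) Finset.univ t)

lemma measurable_expIntegrand_stick (k : ℕ) : Measurable fun q : ℝ × (Fin k → ℝ) =>
    expIntegrand (∏ i, (1 - q.2 i)) (stick q.2) Finset.univ q.1 := by
  have : Continuous fun q : ℝ × (Fin k → ℝ) =>
      expIntegrand (∏ i, (1 - q.2 i)) (stick q.2) Finset.univ q.1 := by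
    have h : ∀ i, Continuous fun q : ℝ × (Fin k → ℝ) => stick q.2 i := fun i =>
      (continuous_stick i).comp continuous_snd
    unfold expIntegrand
    fun_prop
  exact this.measurable

lemma measurable_clockDensity (k : ℕ) : Measurable (clockDensity k) :=
  Measurable.lintegral_prod_right' (f := fun q : ℝ × (Fin k → ℝ) => ENNReal.ofReal
    (expIntegrand (∏ i, (1 - q.2 i)) (stick q.2) Finset.univ q.1))
    (measurable_expIntegrand_stick k).ennreal_ofReal

lemma clockDensity_zero (t : ℝ) : clockDensity 0 t = ENNReal.ofReal (Real.exp (-t)) := by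
  have : openCube 0 = Set.univ := by
    ext w
    simp [openCube]
  simp [clockDensity, expIntegrand, this, volume_pi]

/-- Breaking off a first stick `a` multiplies all later lengths and the remainder by `1 - a`, which
amounts to a change of time scale. -/
lemma expIntegrand_cons {k : ℕ} (a t : ℝ) (w : Fin k → ℝ) :
    expIntegrand (∏ i, (1 - (Fin.cons a w : Fin (k + 1) → ℝ) i)) (stick (Fin.cons a w))
        Finset.univ t =
      (1 - a) * (1 - Real.exp (-a * t)) *
        expIntegrand (∏ i, (1 - w i)) (stick w) Finset.univ ((1 - a) * t) := by
  simp only [expIntegrand, Fin.prod_univ_succ, Fin.cons_zero, Fin.cons_succ, stick_cons_zero,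
    stick_cons_succ]
  have h1 : ∀ c : ℝ, -((1 - a) * c) * t = -c * ((1 - a) * t) := fun c => by ring
  simp only [h1]
  ring

lemma clockDensity_succ (k : ℕ) {t : ℝ} (ht : 0 < t) :
    clockDensity (k + 1) t =
      ∫⁻ s in Set.Ioi (0 : ℝ), ENNReal.ofReal (stickKernel t s) * clockDensity k s := by
  have hmeas : Measurable fun w : Fin (k + 1) → ℝ =>
      ENNReal.ofReal (expIntegrand (∏ i, (1 - w i)) (stick w) Finset.univ t) :=
    ((measurable_expIntegrand_stick (k + 1)).comp measurable_prodMk_left).ennreal_ofReal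
  -- Substitution `s = (1 - a) * t`, which turns the average over the first factor into an integral
  -- against `stickKernel t`.
  have himg : (fun a : ℝ => (1 - a) * t) '' Set.Ioo 0 1 = Set.Ioo 0 t := by
    ext s
    simp only [Set.mem_image, Set.mem_Ioo]
    constructor
    · rintro ⟨a, ⟨h0, h1⟩, rfl⟩
      constructor <;> nlinarith
    · rintro ⟨h0, h1⟩
      refine ⟨1 - s / t, ⟨by linarith [(div_lt_one ht).2 h1], by linarith [div_pos h0 ht]⟩, ?_⟩
      field_simp
      ring
  have hinj : Set.InjOn (fun a : ℝ => (1 - a) * t) (Set.Ioo 0 1) := fun a _ b _ h => by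
    have := mul_right_cancel₀ ht.ne' h
    linarith
  have hcov := lintegral_image_eq_lintegral_abs_deriv_mul (f' := fun _ => -t)
    measurableSet_Ioo (fun a _ => ((((hasDerivAt_id' a).const_sub 1).mul_const t).congr_deriv
      (by ring)).hasDerivWithinAt) hinj
    (fun s => ENNReal.ofReal (stickKernel t s) * clockDensity k s)
  have hsub : ∫⁻ s in Set.Ioi (0 : ℝ), ENNReal.ofReal (stickKernel t s) * clockDensity k s =
      ∫⁻ s in Set.Ioo 0 t, ENNReal.ofReal (stickKernel t s) * clockDensity k s := by
    rw [← lintegral_indicator measurableSet_Ioi, ← lintegral_indicator measurableSet_Ioo]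
    refine lintegral_congr fun s => ?_
    by_cases hs : 0 < s
    · by_cases hst : s < t
      · rw [Set.indicator_of_mem (Set.mem_Ioi.2 hs), Set.indicator_of_mem (Set.mem_Ioo.2 ⟨hs, hst⟩)]
      · rw [Set.indicator_of_mem (Set.mem_Ioi.2 hs),
          Set.indicator_of_notMem fun h => hst (Set.mem_Ioo.1 h).2,
          ENNReal.ofReal_of_nonpos (stickKernel_nonpos hs.le (not_lt.1 hst)), zero_mul]
    · rw [Set.indicator_of_notMem fun h => hs (Set.mem_Ioi.1 h),
        Set.indicator_of_notMem fun h => hs (Set.mem_Ioo.1 h).1]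
  rw [hsub, ← himg, hcov, clockDensity, setLIntegral_openCube_succ hmeas]
  refine setLIntegral_congr_fun measurableSet_Ioo fun a ha => ?_
  obtain ⟨h0, h1⟩ := Set.mem_Ioo.1 ha
  have he : Real.exp (-a * t) ≤ 1 := Real.exp_le_one_iff.2 (by nlinarith)
  have hnn : 0 ≤ (1 - a) * (1 - Real.exp (-a * t)) := mul_nonneg (by linarith) (by linarith)
  simp only [expIntegrand_cons, ENNReal.ofReal_mul hnn]
  rw [lintegral_const_mul' _ _ ENNReal.ofReal_ne_top, ← mul_assoc,
    ← ENNReal.ofReal_mul (abs_nonneg _), clockDensity]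
  congr 2
  have hexp : -(t - (1 - a) * t) = -a * t := by ring
  rw [abs_neg, abs_of_pos ht, stickKernel, hexp]
  field_simp

/-- Tonelli moves the kernel onto the eigenfunction, so each stick contributes one factor `1 / (n +
1)`. -/
lemma lintegral_clockDensity_mul_eigenfunction (k n : ℕ) :
    ∫⁻ t in Set.Ioi (0 : ℝ), clockDensity k t * eigenfunction n t =
      ENNReal.ofReal (2 / ((n + 1) ^ (k + 1) * (n + 2) * (n + 3))) := by
  induction k with
  | zero => simp only [clockDensity_zero, lintegral_exp_mul_eigenfunction, zero_add, pow_one]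
  | succ k ih =>
    have hK : Measurable fun q : ℝ × ℝ => ENNReal.ofReal (stickKernel q.1 q.2) :=
      measurable_stickKernel.ennreal_ofReal
    have hf := measurable_clockDensity k
    have he := measurable_eigenfunction n
    have h1 : ∀ t ∈ Set.Ioi (0 : ℝ), clockDensity (k + 1) t * eigenfunction n t =
        ∫⁻ s in Set.Ioi (0 : ℝ),
          ENNReal.ofReal (stickKernel t s) * clockDensity k s * eigenfunction n t := fun t ht => by
      rw [clockDensity_succ k ht, lintegral_mul_const]
      exact (hK.comp measurable_prodMk_left).mul hf
    rw [setLIntegral_congr_fun measurableSet_Ioi h1, lintegral_lintegral_swap]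
    · have h2 : ∀ s ∈ Set.Ioi (0 : ℝ), ∫⁻ t in Set.Ioi (0 : ℝ),
          ENNReal.ofReal (stickKernel t s) * clockDensity k s * eigenfunction n t =
          ENNReal.ofReal (1 / (n + 1)) * (clockDensity k s * eigenfunction n s) := fun s hs => by
        simp_rw [mul_right_comm _ (clockDensity k s) _]
        have hm : Measurable fun t => ENNReal.ofReal (stickKernel t s) * eigenfunction n t :=
          (hK.comp measurable_prodMk_right).mul he
        rw [lintegral_mul_const _ hm,
          lintegral_stickKernel_mul_eigenfunction n hs]
        ring
      rw [setLIntegral_congr_fun measurableSet_Ioi h2,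
        lintegral_const_mul' _ _ ENNReal.ofReal_ne_top, ih, ← ENNReal.ofReal_mul (by positivity)]
      congr 1
      rw [pow_succ _ (k + 1)]
      field_simp
    · refine Measurable.aemeasurable ?_
      exact (hK.mul (hf.comp measurable_snd)).mul (he.comp measurable_fst)

lemma lintegral_clockDensity (k : ℕ) :
    ∫⁻ t in Set.Ioi (0 : ℝ), clockDensity k t =
      ∑' n : ℕ, ENNReal.ofReal (2 / ((n + 1) ^ k * (n + 2) * (n + 3))) := by
  have h1 : ∀ t ∈ Set.Ioi (0 : ℝ), clockDensity k t =
      ∑' n : ℕ, ENNReal.ofReal (n + 1) * (clockDensity k t * eigenfunction n t) := fun t ht => by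
    simp_rw [mul_left_comm _ (clockDensity k t)]
    rw [ENNReal.tsum_mul_left, tsum_mul_eigenfunction ht, mul_one]
  have h2 : ∀ n : ℕ, Measurable fun t =>
      ENNReal.ofReal (n + 1) * (clockDensity k t * eigenfunction n t) := fun n =>
    ((measurable_clockDensity k).mul (measurable_eigenfunction n)).const_mul _
  rw [setLIntegral_congr_fun measurableSet_Ioi h1, lintegral_tsum fun n => (h2 n).aemeasurable]
  refine tsum_congr fun n => ?_
  rw [lintegral_const_mul' _ _ ENNReal.ofReal_ne_top, lintegral_clockDensity_mul_eigenfunction,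
    ← ENNReal.ofReal_mul (by positivity)]
  congr 1
  rw [pow_succ]
  field_simp

lemma lintegral_openCube_expIntegral (k : ℕ) :
    ∫⁻ w in openCube k, ∫⁻ t in Set.Ioi (0 : ℝ),
        ENNReal.ofReal (expIntegrand (∏ i, (1 - w i)) (stick w) Finset.univ t) =
      ∑' n : ℕ, ENNReal.ofReal (2 / ((n + 1) ^ k * (n + 2) * (n + 3))) := by
  rw [← lintegral_clockDensity, lintegral_lintegral_swap]
  · rfl
  · exact ((measurable_expIntegrand_stick k).comp measurable_swap).ennreal_ofReal.aemeasurable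

/-! ### Evaluation of the series by zeta values -/

section ZetaValues

open Filter Topology

lemma hasSum_one_div_mul_add_one :
    HasSum (fun j : ℕ => 1 / (((j : ℝ) + 1) * (j + 2))) 1 := by
  have hlim : Tendsto (fun n : ℕ => 1 - 1 / ((n : ℝ) + 1)) atTop (𝓝 (1 - 0)) :=
    tendsto_one_div_add_atTop_nhds_zero_nat.const_sub 1
  rw [sub_zero] at hlim
  refine (hasSum_iff_tendsto_nat_of_nonneg (fun j => by positivity) _).2 (hlim.congr fun n => ?_)
  induction n with
  | zero => simp
  | succ n ih =>
    rw [Finset.sum_range_succ, ← ih]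
    push_cast
    field_simp
    ring

lemma hasSum_one_div_mul_add_two :
    HasSum (fun j : ℕ => 1 / (((j : ℝ) + 1) * (j + 3))) (3 / 4) := by
  have h1 : Tendsto (fun n : ℕ => 1 / ((n : ℝ) + 1)) atTop (𝓝 0) :=
    tendsto_one_div_add_atTop_nhds_zero_nat
  have h2 := (tendsto_add_atTop_iff_nat 1).2 h1
  have hlim := ((h1.add h2).div_const 2).const_sub (3 / 4)
  norm_num at hlim
  refine (hasSum_iff_tendsto_nat_of_nonneg (fun j => by positivity) _).2 (hlim.congr fun n => ?_)
  induction n with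
  | zero => norm_num
  | succ n ih =>
    rw [Finset.sum_range_succ, ← ih]
    push_cast
    field_simp
    ring

/-- The real number `ζ(k)`, for `k ≥ 2`. -/
noncomputable def realZeta (k : ℕ) : ℝ := ∑' j : ℕ, 1 / ((j : ℝ) + 1) ^ k

lemma hasSum_realZeta {k : ℕ} (hk : 2 ≤ k) :
    HasSum (fun j : ℕ => 1 / ((j : ℝ) + 1) ^ k) (realZeta k) := by
  have h := (summable_nat_add_iff 1).2 (Real.summable_one_div_nat_pow.2 (show 1 < k by omega))
  push_cast at h
  exact h.hasSum

lemma ofReal_realZeta {k : ℕ} (hk : 2 ≤ k) : (realZeta k : ℂ) = riemannZeta k := by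
  have h : Summable fun n : ℕ => 1 / (n : ℂ) ^ k := by
    have h0 : Summable fun n : ℕ => ((1 / (n : ℝ) ^ k : ℝ) : ℂ) :=
      Complex.summable_ofReal.2 (Real.summable_one_div_nat_pow.2 (show 1 < k by omega))
    simpa using h0
  rw [zeta_nat_eq_tsum_of_gt_one (show 1 < k by omega), h.tsum_eq_zero_add, realZeta,
    Complex.ofReal_tsum]
  -- The term at index `0` is `1 / 0 ^ k`, which is `0` as `k ≠ 0`.
  simp [show k ≠ 0 by omega]

/-- With `m = j + 1`, induct by `1 / (m^(k+2) (m+1)) = 1 / m^(k+2) - 1 / (m^(k+1) (m+1))`. -/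
lemma hasSum_one_div_pow_mul_add_one (k : ℕ) :
    HasSum (fun j : ℕ => 1 / (((j : ℝ) + 1) ^ (k + 1) * (j + 2)))
      ((-1) ^ k + ∑ j ∈ Finset.Icc 2 (k + 1), (-1) ^ (k + 1 - j) * realZeta j) := by
  induction k with
  | zero => simpa using hasSum_one_div_mul_add_one
  | succ k ih =>
    rw [Finset.sum_Icc_succ_top (by omega)]
    have h := (hasSum_realZeta (k := k + 2) (by omega)).sub ih
    have hs : ∑ j ∈ Finset.Icc 2 (k + 1), (-1 : ℝ) ^ (k + 1 + 1 - j) * realZeta j =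
        -∑ j ∈ Finset.Icc 2 (k + 1), (-1 : ℝ) ^ (k + 1 - j) * realZeta j := by
      rw [← Finset.sum_neg_distrib]
      refine Finset.sum_congr rfl fun j hj => ?_
      rw [show k + 1 + 1 - j = k + 1 - j + 1 by have := Finset.mem_Icc.1 hj; omega, pow_succ]
      ring
    have hv : (-1 : ℝ) ^ (k + 1) + (∑ j ∈ Finset.Icc 2 (k + 1),
        (-1) ^ (k + 1 + 1 - j) * realZeta j + (-1) ^ (k + 1 + 1 - (k + 1 + 1)) *
          realZeta (k + 1 + 1)) = realZeta (k + 2) - ((-1) ^ k +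
        ∑ j ∈ Finset.Icc 2 (k + 1), (-1) ^ (k + 1 - j) * realZeta j) := by
      rw [hs, Nat.sub_self]
      ring
    rw [hv]
    refine h.congr_fun fun j => ?_
    field_simp
    ring

/-- The same induction with `m + 2` in place of `m + 1`; the gap `2` between `m` and `m + 2` halves
the right side at each step, whence the powers of `2`. -/
lemma hasSum_one_div_pow_mul_add_two (k : ℕ) :
    HasSum (fun j : ℕ => 1 / (((j : ℝ) + 1) ^ (k + 1) * (j + 3)))
      ((-1) ^ k * (3 / 2 ^ (k + 2)) +
        ∑ j ∈ Finset.Icc 2 (k + 1), (-1) ^ (k + 1 - j) / 2 ^ (k + 1 - j + 1) * realZeta j) := by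
  induction k with
  | zero =>
    have := hasSum_one_div_mul_add_two
    norm_num at this ⊢
    exact this
  | succ k ih =>
    rw [Finset.sum_Icc_succ_top (by omega)]
    have h := ((hasSum_realZeta (k := k + 2) (by omega)).sub ih).div_const 2
    have hs : ∑ j ∈ Finset.Icc 2 (k + 1),
        (-1 : ℝ) ^ (k + 1 + 1 - j) / 2 ^ (k + 1 + 1 - j + 1) * realZeta j =
        -(∑ j ∈ Finset.Icc 2 (k + 1),
          (-1 : ℝ) ^ (k + 1 - j) / 2 ^ (k + 1 - j + 1) * realZeta j) / 2 := by
      rw [← Finset.sum_neg_distrib, Finset.sum_div]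
      refine Finset.sum_congr rfl fun j hj => ?_
      rw [show k + 1 + 1 - j = k + 1 - j + 1 by have := Finset.mem_Icc.1 hj; omega,
        pow_succ (-1 : ℝ), pow_succ (2 : ℝ) (k + 1 - j + 1)]
      ring
    have hv : (-1 : ℝ) ^ (k + 1) * (3 / 2 ^ (k + 1 + 2)) + (∑ j ∈ Finset.Icc 2 (k + 1),
        (-1) ^ (k + 1 + 1 - j) / 2 ^ (k + 1 + 1 - j + 1) * realZeta j +
          (-1) ^ (k + 1 + 1 - (k + 1 + 1)) / 2 ^ (k + 1 + 1 - (k + 1 + 1) + 1) *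
            realZeta (k + 1 + 1)) = (realZeta (k + 2) - ((-1) ^ k * (3 / 2 ^ (k + 2)) +
        ∑ j ∈ Finset.Icc 2 (k + 1),
          (-1) ^ (k + 1 - j) / 2 ^ (k + 1 - j + 1) * realZeta j)) / 2 := by
      rw [hs, Nat.sub_self]
      ring
    rw [hv]
    refine h.congr_fun fun j => ?_
    field_simp
    ring

lemma hasSum_two_div {k : ℕ} (hk : 1 ≤ k) :
    HasSum (fun j : ℕ => (2 : ℝ) / (((j : ℝ) + 1) ^ k * ((j : ℝ) + 2) * ((j : ℝ) + 3)))
      ((-1) ^ (k - 1) * (2 - 3 / 2 ^ k) +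
        ∑ j ∈ Finset.Icc 2 k, (-1) ^ (k - j) * (2 - 1 / 2 ^ (k - j)) * realZeta j) := by
  obtain ⟨k, rfl⟩ := Nat.exists_eq_add_of_le' hk
  have h := ((hasSum_one_div_pow_mul_add_one k).sub (hasSum_one_div_pow_mul_add_two k)).mul_left 2
  have hv : (-1 : ℝ) ^ (k + 1 - 1) * (2 - 3 / 2 ^ (k + 1)) + ∑ j ∈ Finset.Icc 2 (k + 1),
      (-1) ^ (k + 1 - j) * (2 - 1 / 2 ^ (k + 1 - j)) * realZeta j =
      2 * ((-1) ^ k + ∑ j ∈ Finset.Icc 2 (k + 1), (-1) ^ (k + 1 - j) * realZeta j -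
        ((-1) ^ k * (3 / 2 ^ (k + 2)) + ∑ j ∈ Finset.Icc 2 (k + 1),
          (-1) ^ (k + 1 - j) / 2 ^ (k + 1 - j + 1) * realZeta j)) := by
    have hs : ∑ j ∈ Finset.Icc 2 (k + 1),
        (-1 : ℝ) ^ (k + 1 - j) * (2 - 1 / 2 ^ (k + 1 - j)) * realZeta j =
        2 * (∑ j ∈ Finset.Icc 2 (k + 1), (-1) ^ (k + 1 - j) * realZeta j -
          ∑ j ∈ Finset.Icc 2 (k + 1),
            (-1) ^ (k + 1 - j) / 2 ^ (k + 1 - j + 1) * realZeta j) := by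
      rw [← Finset.sum_sub_distrib, Finset.mul_sum]
      refine Finset.sum_congr rfl fun j _ => ?_
      rw [pow_succ (2 : ℝ)]
      field_simp
    rw [hs, Nat.add_sub_cancel]
    ring
  rw [hv]
  refine h.congr_fun fun j => ?_
  field_simp
  ring

end ZetaValues

/-! ### The integrals over the cube -/

lemma prod_add_sum_stick {k : ℕ} (w : Fin k → ℝ) : ∏ i, (1 - w i) + ∑ i, stick w i = 1 := by
  induction k with
  | zero => simp
  | succ k ih =>
    have h := ih (Fin.tail w)
    rw [← Fin.cons_self_tail w, Fin.prod_univ_succ, Fin.sum_univ_succ]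
    simp only [stick_cons_zero, stick_cons_succ, Fin.cons_zero, Fin.cons_succ, ← Finset.mul_sum]
    linear_combination (1 - w 0) * h

lemma stick_pos {ι : Type} [LinearOrder ι] [LocallyFiniteOrderBot ι] {w : ι → ℝ}
    (hw : ∀ i, w i ∈ Set.Ioo (0 : ℝ) 1) (i : ι) : 0 < stick w i :=
  mul_pos (Finset.prod_pos fun j _ => sub_pos.2 (hw j).2) (hw i).1

lemma mem_openCube {k : ℕ} {w : Fin k → ℝ} :
    w ∈ openCube k ↔ ∀ i, w i ∈ Set.Ioo (0 : ℝ) 1 := by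
  simp [openCube]

lemma prod_one_sub_pos {k : ℕ} {w : Fin k → ℝ} (hw : w ∈ openCube k) : 0 < ∏ i, (1 - w i) :=
  Finset.prod_pos fun i _ => sub_pos.2 (mem_openCube.1 hw i).2

lemma sum_orderIntegrand {k : ℕ} {w : Fin k → ℝ} (hw : w ∈ openCube k) :
    ∑ π : Equiv.Perm (Fin k), orderIntegrand π w =
      expIntegral (∏ i, (1 - w i)) (stick w) Finset.univ := by
  rw [← sum_perm_prod_eq_expIntegral (prod_one_sub_pos hw) k (stick w)
    fun i => (stick_pos (mem_openCube.1 hw) i).le, prod_add_sum_stick]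
  rfl

/-- Each denominator is the mass not yet discovered, which contains the stick in the numerator. So
every factor lies in `[0, 1]`, and the integrals converge absolutely. -/
lemma orderIntegrand_mem {k : ℕ} (π : Equiv.Perm (Fin k)) {w : Fin k → ℝ} (hw : w ∈ openCube k) :
    orderIntegrand π w ∈ Set.Icc (0 : ℝ) 1 := by
  have hpos := stick_pos (mem_openCube.1 hw)
  have hden : ∀ i, stick w (π i) ≤ 1 - ∑ j ∈ Finset.Iio i, stick w (π j) := fun i => by
    have h1 : stick w (π i) + ∑ j ∈ Finset.Iio i, stick w (π j) ≤ ∑ j, stick w (π j) := by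
      rw [← Finset.sum_insert (f := fun j => stick w (π j)) (by simp : i ∉ Finset.Iio i)]
      exact Finset.sum_le_sum_of_subset_of_nonneg (Finset.subset_univ _)
        fun j _ _ => (hpos _).le
    rw [Equiv.sum_comp π (stick w)] at h1
    linarith [prod_add_sum_stick w, prod_one_sub_pos hw]
  have hnn : ∀ i, 0 ≤ stick w (π i) / (1 - ∑ j ∈ Finset.Iio i, stick w (π j)) := fun i =>
    div_nonneg (hpos _).le ((hpos _).le.trans (hden i))
  exact ⟨Finset.prod_nonneg fun i _ => hnn i, Finset.prod_le_one (fun i _ => hnn i)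
    fun i _ => div_le_one_of_le₀ (hden i) ((hpos _).le.trans (hden i))⟩

lemma volume_openCube (k : ℕ) : volume (openCube k) = 1 := by
  rw [openCube, Real.volume_pi_Ioo]
  simp

lemma measurable_orderIntegrand {k : ℕ} (π : Equiv.Perm (Fin k)) :
    Measurable (orderIntegrand π) := by
  have h : ∀ i : Fin k, Measurable fun w : Fin k → ℝ => stick w i := fun i =>
    (continuous_stick i).measurable
  unfold orderIntegrand
  fun_prop

lemma integrableOn_orderIntegrand {k : ℕ} (π : Equiv.Perm (Fin k)) :
    IntegrableOn (orderIntegrand π) (openCube k) := by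
  refine Measure.integrableOn_of_bounded (M := 1) (by simp [volume_openCube])
    (measurable_orderIntegrand π).aestronglyMeasurable ?_
  refine (ae_restrict_iff' (measurableSet_openCube k)).2 (ae_of_all _ fun w hw => ?_)
  rw [Real.norm_of_nonneg (orderIntegrand_mem π hw).1]
  exact (orderIntegrand_mem π hw).2

lemma ofReal_expIntegral {k : ℕ} {w : Fin k → ℝ} (hw : w ∈ openCube k) :
    ENNReal.ofReal (expIntegral (∏ i, (1 - w i)) (stick w) Finset.univ) =
      ∫⁻ t in Set.Ioi (0 : ℝ),
        ENNReal.ofReal (expIntegrand (∏ i, (1 - w i)) (stick w) Finset.univ t) := by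
  have hp : ∀ i ∈ Finset.univ, 0 ≤ stick w i := fun i _ => (stick_pos (mem_openCube.1 hw) i).le
  refine ofReal_integral_eq_lintegral_ofReal
    (integrableOn_expIntegrand (prod_one_sub_pos hw) hp) ?_
  exact (ae_restrict_iff' measurableSet_Ioi).2 (ae_of_all _ fun t ht =>
    expIntegrand_nonneg (prod_one_sub_pos hw).le hp (le_of_lt ht))

lemma orderIntegralSum_eq_toReal (k : ℕ) :
    orderIntegralSum k =
      (∑' n : ℕ, ENNReal.ofReal (2 / ((n + 1) ^ k * (n + 2) * (n + 3)))).toReal := by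
  have hint : IntegrableOn (fun w => ∑ π : Equiv.Perm (Fin k), orderIntegrand π w)
      (openCube k) := integrable_finsetSum _ fun π _ => integrableOn_orderIntegrand π
  rw [orderIntegralSum, ← integral_finsetSum _ fun π _ => integrableOn_orderIntegrand π,
    integral_eq_lintegral_of_nonneg_ae _ hint.1]
  · rw [← lintegral_openCube_expIntegral]
    congr 1
    refine setLIntegral_congr_fun (measurableSet_openCube k) fun w hw => ?_
    rw [← ofReal_expIntegral hw, ← sum_orderIntegrand hw]
  · exact (ae_restrict_iff' (measurableSet_openCube k)).2 (ae_of_all _ fun w hw =>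
      Finset.sum_nonneg fun π _ => (orderIntegrand_mem π hw).1)

lemma hasSum_orderIntegralSum {k : ℕ} (hk : 1 ≤ k) :
    HasSum (fun j : ℕ => (2 : ℝ) / (((j : ℝ) + 1) ^ k * ((j : ℝ) + 2) * ((j : ℝ) + 3)))
      (orderIntegralSum k) := by
  have h := (hasSum_two_div hk).summable
  rw [orderIntegralSum_eq_toReal, ← ENNReal.ofReal_tsum_of_nonneg (fun n => by positivity) h,
    ENNReal.toReal_ofReal (tsum_nonneg fun n => by positivity)]
  exact h.hasSum

lemma orderIntegralSum_eq_zeta {k : ℕ} (hk : 1 ≤ k) :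
    (orderIntegralSum k : ℂ) =
      (-1) ^ (k - 1) * (2 - 3 / 2 ^ k) +
        ∑ j ∈ Finset.Icc 2 k, (-1) ^ (k - j) * (2 - 1 / 2 ^ (k - j)) * riemannZeta (j : ℂ) := by
  rw [(hasSum_orderIntegralSum hk).unique (hasSum_two_div hk)]
  push_cast
  congr 1
  exact Finset.sum_congr rfl fun j hj => by rw [ofReal_realZeta (Finset.mem_Icc.1 hj).1]

/-! ### The probability of the discovery event -/

lemma stick_comp_val (w : ℕ → ℝ) {k : ℕ} (i : Fin k) :
    stick (fun j : Fin k => w j) i = stick w i := by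
  rw [stick, stick, ← Fin.map_valEmbedding_Iio, Finset.prod_map]
  rfl

lemma prod_add_endpoint (w : ℕ → ℝ) (k : ℕ) :
    ∏ i ∈ Finset.range k, (1 - w i) + endpoint w k = 1 := by
  have h := prod_add_sum_stick fun i : Fin k => w i
  simp only [stick_comp_val] at h
  rw [endpoint, Finset.prod_range, Finset.sum_range]
  exact h

/-- Rewriting `j < exitTime` as `j + 1 ≤ exitTime` allows the infimum to be tested termwise,
including when it is `⊤`. -/
lemma lt_exitTime_iff (w x : ℕ → ℝ) (k j : ℕ) :
    (j : ℕ∞) < exitTime w x k ↔ ∀ l ≤ j, x l ∈ Set.Ico 0 (endpoint w k) := by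
  rw [← ENat.add_one_le_iff (ENat.natCast_ne_top j), exitTime]
  simp only [le_iInf_iff]
  constructor
  · intro h l hl
    by_contra hx
    have := h l hx
    norm_cast at this
    omega
  · intro h n hn
    norm_cast
    by_contra hlt
    exact hn (h n (by omega))

lemma measurable_endpoint (k : ℕ) : Measurable fun w : ℕ → ℝ => endpoint w k := by
  unfold endpoint stick
  fun_prop

lemma measurableSet_discoveryEvent (k : ℕ) : MeasurableSet (discoveryEvent k) := by
  have hset : discoveryEvent k = ⋂ i ∈ Finset.range k, ⋃ j : ℕ,
      ((⋂ l ∈ Finset.Iic j, {ω : (ℕ → ℝ) × (ℕ → ℝ) | 0 ≤ ω.2 l ∧ ω.2 l < endpoint ω.1 k}) ∩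
        {ω | endpoint ω.1 i ≤ ω.2 j ∧ ω.2 j < endpoint ω.1 (i + 1)}) := by
    ext ω
    simp [discoveryEvent, lt_exitTime_iff, interval]
  have he : ∀ i, Measurable fun ω : (ℕ → ℝ) × (ℕ → ℝ) => endpoint ω.1 i := fun i =>
    (measurable_endpoint i).comp measurable_fst
  have hx : ∀ j, Measurable fun ω : (ℕ → ℝ) × (ℕ → ℝ) => ω.2 j := fun j =>
    (measurable_pi_apply j).comp measurable_snd
  rw [hset]
  refine Finset.measurableSet_biInter _ fun i _ => MeasurableSet.iUnion fun j =>
    (Finset.measurableSet_biInter _ fun l _ => ?_).inter ?_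
  · exact (measurableSet_le measurable_const (hx l)).inter (measurableSet_lt (hx l) (he k))
  · exact (measurableSet_le (he i) (hx j)).inter (measurableSet_lt (hx j) (he (i + 1)))

section Conditional

variable {w : ℕ → ℝ}

lemma monotone_endpoint (hw : ∀ i, w i ∈ Set.Ioo (0 : ℝ) 1) : Monotone (endpoint w) :=
  monotone_nat_of_le_succ fun n => by
    rw [endpoint, endpoint, Finset.sum_range_succ]
    linarith [stick_pos hw n]

lemma endpoint_mem (hw : ∀ i, w i ∈ Set.Ioo (0 : ℝ) 1) (k : ℕ) :
    endpoint w k ∈ Set.Icc (0 : ℝ) 1 := by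
  refine ⟨Finset.sum_nonneg fun i _ => (stick_pos hw i).le, ?_⟩
  have : 0 < ∏ i ∈ Finset.range k, (1 - w i) := Finset.prod_pos fun i _ => sub_pos.2 (hw i).2
  linarith [prod_add_endpoint w k]

lemma uniform01_real_interval (hw : ∀ i, w i ∈ Set.Ioo (0 : ℝ) 1) (i : ℕ) :
    uniform01.real (interval w i) = stick w i := by
  have hsub : interval w i ⊆ Set.Icc 0 1 := fun x hx =>
    ⟨(endpoint_mem hw i).1.trans hx.1, hx.2.le.trans (endpoint_mem hw (i + 1)).2⟩
  have hm : MeasurableSet (interval w i) := measurableSet_Ico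
  rw [uniform01, measureReal_restrict_apply hm, Set.inter_eq_left.2 hsub, interval,
    Real.volume_real_Ico_of_le (monotone_endpoint hw i.le_succ), endpoint, endpoint,
    Finset.sum_range_succ]
  ring

lemma exists_mem_interval_iff (hw : ∀ i, w i ∈ Set.Ioo (0 : ℝ) 1) (k : ℕ) (y : ℝ) :
    (∃ m ∈ Finset.range k, y ∈ interval w m) ↔ y ∈ Set.Ico 0 (endpoint w k) := by
  induction k with
  | zero => simp [endpoint]
  | succ k ih =>
    rw [← Set.Ico_union_Ico_eq_Ico (endpoint_mem hw k).1 (monotone_endpoint hw k.le_succ),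
      Set.mem_union, ← ih, Finset.range_add_one]
    simp [interval, or_comm]

lemma preimage_discoveryEvent (hw : ∀ i, w i ∈ Set.Ioo (0 : ℝ) 1) (k : ℕ) :
    Prod.mk w ⁻¹' discoveryEvent k =
      hitSet (interval w) (Finset.range k) (Finset.range k) := by
  ext x
  simp only [discoveryEvent, hitSet, Set.mem_preimage, Set.mem_ofPred_eq, lt_exitTime_iff,
    exists_mem_interval_iff hw]
  simp only [Finset.mem_range, and_comm]

lemma measure_preimage_discoveryEvent (hw : ∀ i, w i ∈ Set.Ioo (0 : ℝ) 1) (k : ℕ) :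
    (Measure.infinitePi fun _ : ℕ => uniform01) (Prod.mk w ⁻¹' discoveryEvent k) =
      ∫⁻ t in Set.Ioi (0 : ℝ), ENNReal.ofReal (expIntegrand (∏ i : Fin k, (1 - w i))
        (stick fun i : Fin k => w i) Finset.univ t) := by
  have hT : 0 < ∏ i ∈ Finset.range k, (1 - w i) := Finset.prod_pos fun i _ => sub_pos.2 (hw i).2
  have h1 := infinitePi_real_hitSet_eq_expIntegral uniform01 (J := interval w)
    (fun i => measurableSet_Ico) (monotone_endpoint hw).pairwise_disjoint_on_Ico_succ
    (K := Finset.range k) hT (by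
      simp only [uniform01_real_interval hw]
      exact prod_add_endpoint w k) (Finset.range k) subset_rfl
  rw [← ofReal_expIntegral (mem_openCube.2 fun i => hw i), preimage_discoveryEvent hw,
    ← ofReal_measureReal, h1]
  congr 1
  refine congrArg (fun f : ℝ → ℝ => ∫ t in Set.Ioi 0, f t) (funext fun t => ?_)
  simp only [expIntegrand, uniform01_real_interval hw, stick_comp_val, Finset.prod_range]

end Conditional

lemma uniform01_eq_restrict_Ioo : uniform01 = volume.restrict (Set.Ioo 0 1) :=
  Measure.restrict_congr_set Ioo_ae_eq_Icc.symm

lemma map_infinitePi_uniform01 (k : ℕ) :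
    (Measure.infinitePi fun _ : ℕ => uniform01).map (fun w (i : Fin k) => w i) =
      volume.restrict (openCube k) := by
  rw [Measure.map_infinitePi_infinitePi_of_inj (P := fun _ : ℕ => uniform01)
    (f := fun i : Fin k => (i : ℕ)) Fin.val_injective, Measure.infinitePi_eq_pi, openCube,
    volume_pi, Measure.restrict_pi_pi, uniform01_eq_restrict_Ioo]

/-- Discards the null set of factors equal to `0` or `1`, so that sticks and remainder are strictly
positive. -/
lemma ae_mem_Ioo : ∀ᵐ w ∂(Measure.infinitePi fun _ : ℕ => uniform01),
    ∀ i, w i ∈ Set.Ioo (0 : ℝ) 1 := by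
  refine ae_all_iff.2 fun i => ?_
  refine (measurePreserving_eval_infinitePi (fun _ : ℕ => uniform01) i).quasiMeasurePreserving.ae ?_
  rw [uniform01_eq_restrict_Ioo]
  exact ae_restrict_mem measurableSet_Ioo

lemma orderIntegralSum_eq_u (k : ℕ) : orderIntegralSum k = u k := by
  rw [orderIntegralSum_eq_toReal, ← lintegral_openCube_expIntegral, ← map_infinitePi_uniform01,
    lintegral_map, u, measureReal_def, samplingLaw,
    Measure.prod_apply (measurableSet_discoveryEvent k)]
  · congr 1
    refine lintegral_congr_ae ?_
    filter_upwards [ae_mem_Ioo] with w hw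
    exact (measure_preimage_discoveryEvent hw k).symm
  · exact Measurable.lintegral_prod_right' (f := fun q : (Fin k → ℝ) × ℝ => ENNReal.ofReal
      (expIntegrand (∏ i, (1 - q.1 i)) (stick q.1) Finset.univ q.2))
      ((measurable_expIntegrand_stick k).comp measurable_swap).ennreal_ofReal
  · fun_prop

end StickBreaking

theorem mainTheorem2 (k : ℕ) (hk : 1 ≤ k) :
    (∀ π : Equiv.Perm (Fin k),
      MeasureTheory.IntegrableOn (StickBreaking.orderIntegrand π) (StickBreaking.openCube k)) ∧
    (StickBreaking.orderIntegralSum k : ℂ) =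
      (-1) ^ (k - 1) * (2 - 3 / 2 ^ k) +
        ∑ j ∈ Finset.Icc 2 k, (-1) ^ (k - j) * (2 - 1 / 2 ^ (k - j)) * riemannZeta (j : ℂ) ∧
    HasSum (fun j : ℕ => (2 : ℝ) / (((j : ℝ) + 1) ^ k * ((j : ℝ) + 2) * ((j : ℝ) + 3)))
      (StickBreaking.orderIntegralSum k) ∧
    StickBreaking.orderIntegralSum k = StickBreaking.u k :=
  ⟨StickBreaking.integrableOn_orderIntegrand, StickBreaking.orderIntegralSum_eq_zeta hk,
    StickBreaking.hasSum_orderIntegralSum hk, StickBreaking.orderIntegralSum_eq_u k⟩
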